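/- Let $\Sigma=\{0,\dots,k-1\}$ and $\Delta=\{0,\dots,m-1\}$ be finite alphabets and let $g,h\colon F(\Sigma)\to F(\Delta)$ be homomorphisms of free groups; the tuple $I=(\Sigma,\Delta,g,h)$ is called an instance, given to an algorithm by the two alphabet sizes and the freely reduced words of the images of the letters of $\Sigma$ under $g$ and under $h$. Write $\operatorname{Eq}(g,h)=\{x\in F(\Sigma)\mid g(x)=h(x)\}$, a free group. Let $\mathcal C^{(\neg\mathrm{inj},\mathrm{inj})}$, $\mathcal C^{(\mathrm{inj},\mathrm{inj})}$ and $\mathcal C^{\mathrm{inj}}$ be the classes of instances in which, respectively, exactly one, both, and at least one of $g,h$ is injective. For a class $\mathcal C$ of instances, the Basis Problem $\operatorname{BP}$ on $\mathcal C$ takes as input an instance in $\mathcal C$ and asks for a free basis of $\operatorname{Eq}(g,h)$, as a list of freely reduced words; the Rank Problem $\operatorname{RP}$ on $\mathcal C$ takes the same input and asks for the rank of $\operatorname{Eq}(g,h)$, that is, the number of elements of a free basis. A solution of either problem is a partial function on inputs that is defined, with a correct value, on all instances in $\mathcal C$ (nothing is required on other inputs); the problem is soluble if it has a partial recursive solution.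 We write $\operatorname{BP}\Leftrightarrow\operatorname{RP}$ on $\mathcal C$ if $\operatorname{BP}$ on $\mathcal C$ is soluble if and only if $\operatorname{RP}$ on $\mathcal C$ is soluble and, moreover, from any solution of either problem, used as an oracle, one can compute a solution of the other. (a) There is an algorithm which, for every instance $I=(\Sigma,\Delta,g,h)$ with at least one of $g,h$ injective, given $I$ and the (finite) rank of $\operatorname{Eq}(g,h)$ as input, halts and outputs a free basis of $\operatorname{Eq}(g,h)$. (b) Let $\mathcal C$ be any of $\mathcal C^{(\neg\mathrm{inj},\mathrm{inj})}$, $\mathcal C^{(\mathrm{inj},\mathrm{inj})}$, $\mathcal C^{\mathrm{inj}}$. Then $\operatorname{BP}\Leftrightarrow\operatorname{RP}$ on $\mathcal C$, and, for every $n\ge 0$, $\operatorname{BP}\Leftrightarrow\operatorname{RP}$ on the class of those instances in $\mathcal C$ with $|\Sigma|=n$. -/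

import Mathlib

namespace FreePCP

open Function

/-- An instance of the Post Correspondence Problem for free groups: finite alphabets
`Σ = {0, …, k - 1}` and `Δ = {0, …, m - 1}`, and homomorphisms `g, h : F(Σ) → F(Δ)`. -/
structure Instance where
  k : ℕ
  m : ℕ
  g : FreeGroup (Fin k) →* FreeGroup (Fin m)
  h : FreeGroup (Fin k) →* FreeGroup (Fin m)

/-- The equaliser `Eq(g, h) = {x ∈ F(Σ) | g x = h x}`. -/
def Instance.eq (I : Instance) : Subgroup (FreeGroup (Fin I.k)) :=
  I.g.eqLocus I.h

/-! ### Instances as finite data -/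

/-- A word over a finite alphabet and its inverses: the letter `(a, true)` stands for the
generator `a` and `(a, false)` for its inverse. -/
abbrev Word := List (ℕ × Bool)

/-- An element of a free group, written down as its freely reduced word. -/
def word {k : ℕ} (x : FreeGroup (Fin k)) : Word :=
  x.toWord.map fun p => (p.1.val, p.2)

/-- The data type of inputs: the sizes of the two alphabets, and two lists of words. -/
abbrev InstanceCode := ℕ × ℕ × List Word × List Word

/-- An instance, written down: the sizes of the alphabets, the images of the letters of `Σ`
under `g`, and the images of the letters of `Σ` under `h`. -/
def Instance.code (I : Instance) : InstanceCode :=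
  (I.k, I.m, List.ofFn fun i => word (I.g (FreeGroup.of i)),
    List.ofFn fun i => word (I.h (FreeGroup.of i)))

/-! ### Classes of instances -/

/-- Exactly one of the two maps is injective. -/
def exactlyOneInj : Set Instance := {I | Xor (Injective I.g) (Injective I.h)}

/-- Both maps are injective. -/
def bothInj : Set Instance := {I | Injective I.g ∧ Injective I.h}

/-- At least one of the two maps is injective. -/
def atLeastOneInj : Set Instance := {I | Injective I.g ∨ Injective I.h}

/-- The source alphabet `Σ` has exactly `n` letters. -/
def ofSize (n : ℕ) : Set Instance := {I | I.k = n}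

/-! ### Bases and rank of the equaliser -/

/-- The list `L` of reduced words is a (free) basis of `Eq(g, h)`. -/
def Instance.IsEqBasis (I : Instance) (L : List Word) : Prop :=
  ∃ B : FreeGroupBasis (Fin L.length) I.eq,
    ∀ i, word (B i : FreeGroup (Fin I.k)) = L.get i

/-- `Eq(g, h)` has finite rank `r`: it has a (free) basis with `r` elements. -/
def Instance.IsEqRank (I : Instance) (r : ℕ) : Prop :=
  Nonempty (FreeGroupBasis (Fin r) I.eq)

/-- The rank is well defined. -/
theorem Instance.IsEqRank.unique {I : Instance} {r s : ℕ} (hr : I.IsEqRank r)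
    (hs : I.IsEqRank s) : r = s := by
  obtain ⟨b⟩ := hr
  obtain ⟨c⟩ := hs
  have e : (Fin r → Multiplicative (ZMod 2)) ≃ (Fin s → Multiplicative (ZMod 2)) :=
    b.lift.trans c.lift.symm
  have hc : Fintype.card (Multiplicative (ZMod 2)) = 2 := ZMod.card 2
  have := Fintype.card_congr e
  simp only [Fintype.card_fun, hc, Fintype.card_fin] at this
  exact Nat.pow_right_injective le_rfl this

/-! ### The Basis Problem and the Rank Problem

Both problems, restricted to a class `C` of instances, are promise problems: the input is (the
code of) an instance that belongs to `C`. An algorithm is a partial recursive function; on every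
instance in `C` it has to halt with a correct output. -/

/-- `f` solves the Basis Problem on the class `C`. -/
def SolvesBP (C : Set Instance) (f : InstanceCode →. List Word) : Prop :=
  ∀ I ∈ C, ∃ L ∈ f I.code, I.IsEqBasis L

/-- `f` solves the Rank Problem on the class `C`. -/
def SolvesRP (C : Set Instance) (f : InstanceCode →. ℕ) : Prop :=
  ∀ I ∈ C, ∃ r ∈ f I.code, I.IsEqRank r

/-- The Basis Problem on the class `C` is algorithmically soluble. -/
def BPSoluble (C : Set Instance) : Prop := ∃ f, Partrec f ∧ SolvesBP C f

/-- The Rank Problem on the class `C` is algorithmically soluble. -/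
def RPSoluble (C : Set Instance) : Prop := ∃ f, Partrec f ∧ SolvesRP C f

/-- A partial function between encodable types, as a partial function on numbers: the form in
which it is used as an oracle. -/
def oracle {α σ : Type} [Primcodable α] [Primcodable σ] (f : α →. σ) : ℕ →. ℕ :=
  fun n => Part.bind (Encodable.decode (α := α) n) fun a => (f a).map Encodable.encode

/-- On the class `C`, the Basis Problem and the Rank Problem are algorithmically equivalent:
one is soluble if and only if the other is, and, more precisely, each of them can be solved by an
algorithm with an arbitrary solution of the other as its oracle. -/
def BPEquivRP (C : Set Instance) : Prop :=
  (BPSoluble C ↔ RPSoluble C) ∧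
  (∀ f, SolvesBP C f → ∃ f', SolvesRP C f' ∧ RecursiveIn {oracle f} f') ∧
  (∀ f, SolvesRP C f → ∃ f', SolvesBP C f' ∧ RecursiveIn {oracle f} f')

end FreePCP

/-! Membership in the equaliser is decidable: compare the reduced words of the two images. In each
left coset choose the word with the least code. Prepending a fixed letter is strictly monotone on
codes, so suffixes of minimal words are minimal and the minimal words form a Schreier transversal
(`minSection`). Minimality is decidable, as only finitely many words have a smaller code.

By Schreier's theorem (`SchreierSection.basis`) the nontrivial elements rep(aq)⁻¹ · a · rep(q) form
a free basis, and they are indexed by a decidable set of triples (`edgeEquiv`). All bases have the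
same size, so for rank r there are exactly r valid triples: enumerate until r have appeared, and
none is missing (`exists_mem_basisFromRank`). Conversely, the length of a basis is the rank. Both
reductions work instance by instance, with one query to the other problem. -/

namespace FreePCP

open Function

/-! ### Schreier bases -/

section Schreier

variable {α : Type*} {H : Subgroup (FreeGroup α)}

/-- A Schreier section of a subgroup `H` of a free group: representatives of the left cosets of
`H` that form a subtree, rooted at the identity, of the Cayley graph. -/
structure SchreierSection (H : Subgroup (FreeGroup α)) where
  rep : FreeGroup α ⧸ H → FreeGroup α
  mk_rep : ∀ q, (rep q : FreeGroup α ⧸ H) = q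
  rep_one : rep ((1 : FreeGroup α) : FreeGroup α ⧸ H) = 1
  height : FreeGroup α ⧸ H → ℕ
  parent : ∀ q, q ≠ ((1 : FreeGroup α) : FreeGroup α ⧸ H) → ∃ p, height p < height q ∧ ∃ a,
    (FreeGroup.of a • p = q ∧ rep q = FreeGroup.of a * rep p) ∨
    (FreeGroup.of a • q = p ∧ rep p = FreeGroup.of a * rep q)

namespace SchreierSection

variable (S : SchreierSection H)

/-- The Schreier generator of `H` attached to an edge of the Schreier graph. -/
def gen (a : α) (q : FreeGroup α ⧸ H) : FreeGroup α :=
  (S.rep (FreeGroup.of a • q))⁻¹ * (FreeGroup.of a * S.rep q)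

theorem gen_mem (a : α) (q : FreeGroup α ⧸ H) : S.gen a q ∈ H := by
  unfold gen
  rw [← QuotientGroup.eq, S.mk_rep, ← smul_eq_mul, ← MulAction.Quotient.smul_coe, S.mk_rep]

/-- The edges of the Schreier graph outside the tree of the section. -/
abbrev Edge : Type _ :=
  {e : α × FreeGroup α ⧸ H // S.gen e.1 e.2 ≠ 1}

/-- The nontrivial Schreier generators, as elements of `H`. -/
def edgeGen (e : S.Edge) : H := ⟨S.gen e.1.1 e.1.2, S.gen_mem _ _⟩

theorem gen_mem_closure (a : α) (q : FreeGroup α ⧸ H) :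
    (⟨S.gen a q, S.gen_mem a q⟩ : H) ∈ Subgroup.closure (Set.range S.edgeGen) := by
  by_cases h : S.gen a q = 1
  · rw [show (⟨S.gen a q, S.gen_mem a q⟩ : H) = 1 from Subtype.ext h]
    exact Subgroup.one_mem _
  · exact Subgroup.subset_closure ⟨⟨(a, q), h⟩, rfl⟩

/-- The nontrivial Schreier generators generate `H`. -/
theorem closure_range_edgeGen : Subgroup.closure (Set.range S.edgeGen) = ⊤ := by
  rw [eq_top_iff]
  set K := Subgroup.closure (Set.range S.edgeGen)
  -- Schreier rewriting: moving a representative past x costs an element of `K`. At the base coset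
  -- with x in `H`, both representatives are 1 and x itself is that element.
  have key : ∀ x : FreeGroup α, ∀ q, ∃ c ∈ K, x * S.rep q = S.rep (x • q) * (c : FreeGroup α) := by
    intro x
    induction x using FreeGroup.induction_on with
    | C1 => exact fun q => ⟨1, K.one_mem, by simp⟩
    | of a =>
      exact fun q => ⟨_, S.gen_mem_closure a q, by simp [gen]⟩
    | inv_of a _ =>
      intro q
      refine ⟨_, K.inv_mem (S.gen_mem_closure a ((FreeGroup.of a)⁻¹ • q)), ?_⟩
      simp [gen, mul_assoc]
    | mul x y hx hy =>
      intro q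
      obtain ⟨c, hc, hcy⟩ := hy q
      obtain ⟨d, hd, hdx⟩ := hx (y • q)
      refine ⟨d * c, K.mul_mem hd hc, ?_⟩
      rw [mul_assoc, hcy, ← mul_assoc, hdx, mul_smul]
      simp [mul_assoc]
  intro x _
  obtain ⟨c, hc, hx⟩ := key x ((1 : FreeGroup α) : FreeGroup α ⧸ H)
  have h1 : (x : FreeGroup α) • ((1 : FreeGroup α) : FreeGroup α ⧸ H) =
        ((1 : FreeGroup α) : FreeGroup α ⧸ H) := by
    rw [MulAction.Quotient.smul_coe, QuotientGroup.eq]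
    simp
  rw [h1, S.rep_one, mul_one, one_mul] at hx
  rwa [Subtype.ext hx]

/-! ### Freeness, via coverings of the Schreier graph -/

variable {G : Type*} [Group G]

open Classical in
/-- The label of an edge of the Schreier graph: a prescribed one outside the tree, and `1` in it. -/
noncomputable def label (f : S.Edge → G) (a : α) (q : FreeGroup α ⧸ H) : G :=
  if h : S.gen a q ≠ 1 then f ⟨(a, q), h⟩ else 1

/-- The permutation by which a letter acts on the covering of the Schreier graph given by the
labels of its edges. -/
noncomputable def letterPerm (f : S.Edge → G) (a : α) : Equiv.Perm ((FreeGroup α ⧸ H) × G) where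
  toFun p := (FreeGroup.of a • p.1, S.label f a p.1 * p.2)
  invFun p := ((FreeGroup.of a)⁻¹ • p.1, (S.label f a ((FreeGroup.of a)⁻¹ • p.1))⁻¹ * p.2)
  left_inv p := by simp
  right_inv p := by simp

/-- The action of the free group on the covering of the Schreier graph. -/
noncomputable def coverHom (f : S.Edge → G) :
    FreeGroup α →* Equiv.Perm ((FreeGroup α ⧸ H) × G) :=
  FreeGroup.lift (S.letterPerm f)

theorem coverHom_of (f : S.Edge → G) (a : α) (p : (FreeGroup α ⧸ H) × G) :
    S.coverHom f (FreeGroup.of a) p = (FreeGroup.of a • p.1, S.label f a p.1 * p.2) := by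
  simp [coverHom, letterPerm]

/-- Labels multiply on the left, so the action commutes with right multiplication on the fibre `G`.
-/
theorem coverHom_apply (f : S.Edge → G) (x : FreeGroup α) :
    ∀ p, S.coverHom f x p = (x • p.1, (S.coverHom f x (p.1, 1)).2 * p.2) := by
  induction x using FreeGroup.induction_on with
  | C1 => simp
  | of a => simp [coverHom_of]
  | inv_of a _ => intro p; simp [coverHom, letterPerm, Equiv.Perm.inv_def]
  | mul x y hx hy =>
    intro p
    rw [map_mul, Equiv.Perm.mul_apply, Equiv.Perm.mul_apply, hx, hy, hx (S.coverHom f y (p.1, 1)),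
      hy (p.1, 1)]
    simp [mul_smul, mul_assoc]

/-- The representative of q is a path in the tree, where all labels are 1, so the fibre coordinate
never changes. -/
theorem coverHom_rep (f : S.Edge → G) (q : FreeGroup α ⧸ H) :
    S.coverHom f (S.rep q) (((1 : FreeGroup α) : FreeGroup α ⧸ H), 1) = (q, 1) := by
  induction hn : S.height q using Nat.strong_induction_on generalizing q with
  | _ n ih =>
    by_cases hq : q = ((1 : FreeGroup α) : FreeGroup α ⧸ H)
    · rw [hq, S.rep_one]; simp
    obtain ⟨p, hp, a, ⟨h1, h2⟩ | ⟨h1, h2⟩⟩ := S.parent q hq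
    · have hl : S.label f a p = 1 := by
        simp [label, gen, h1, h2]
      rw [h2, map_mul, Equiv.Perm.mul_apply, ih _ (hn ▸ hp) p rfl, coverHom_of]
      simp [h1, hl]
    · have hl : S.label f a q = 1 := by
        simp [label, gen, h1, h2]
      have := ih _ (hn ▸ hp) p rfl
      rw [h2, map_mul, Equiv.Perm.mul_apply] at this
      -- Here the tree edge points from q to its parent p, so both sides are compared after crossing
      -- it.
      apply (S.coverHom f (FreeGroup.of a)).injective
      rw [this, coverHom_of]
      simp [h1, hl]

/-- The homomorphism on `H` with prescribed values on the Schreier generators. -/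
noncomputable def liftHom (f : S.Edge → G) : H →* G where
  toFun x := (S.coverHom f x (((1 : FreeGroup α) : FreeGroup α ⧸ H), 1)).2
  map_one' := by simp
  map_mul' x y := by
    -- Elements of `H` fix the base coset, which makes the fibre coordinate multiplicative.
    have h1 : (y : FreeGroup α) • ((1 : FreeGroup α) : FreeGroup α ⧸ H) =
        ((1 : FreeGroup α) : FreeGroup α ⧸ H) := by
      rw [MulAction.Quotient.smul_coe, QuotientGroup.eq]
      simp
    rw [Subgroup.coe_mul, map_mul, Equiv.Perm.mul_apply, S.coverHom_apply f x, S.coverHom_apply f y]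
    simp [h1]

/-- The generator is a loop: out along the tree, across the edge, back along the tree. Only the
middle edge contributes a label. -/
theorem liftHom_edgeGen (f : S.Edge → G) (e : S.Edge) : S.liftHom f (S.edgeGen e) = f e := by
  obtain ⟨⟨a, q⟩, h⟩ := e
  have hl : S.label f a q = f ⟨(a, q), h⟩ := by simp [label, h]
  have key : S.coverHom f (S.gen a q) (((1 : FreeGroup α) : FreeGroup α ⧸ H), 1) =
      (((1 : FreeGroup α) : FreeGroup α ⧸ H), f ⟨(a, q), h⟩) := by
    apply (S.coverHom f (S.rep (FreeGroup.of a • q))).injective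
    rw [← Equiv.Perm.mul_apply, ← map_mul, gen, mul_inv_cancel_left, map_mul, Equiv.Perm.mul_apply,
      coverHom_rep, coverHom_of, coverHom_apply, coverHom_rep]
    have := congrArg Prod.fst (S.coverHom_rep f (FreeGroup.of a • q))
    rw [coverHom_apply] at this
    simpa [hl] using this.symm
  exact congrArg Prod.snd key

/-- **Schreier's theorem**: the nontrivial Schreier generators form a basis of `H`. -/
noncomputable def basis : FreeGroupBasis S.Edge H :=
  .ofRepr <| MulEquiv.symm <| MulEquiv.ofBijective (FreeGroup.lift S.edgeGen) <| by
    constructor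
    -- Labelling each edge by its own free generator gives a left inverse.
    · refine HasLeftInverse.injective ⟨S.liftHom FreeGroup.of, fun x => ?_⟩
      have : (S.liftHom FreeGroup.of).comp (FreeGroup.lift S.edgeGen) = MonoidHom.id _ := by
        ext e; simp [liftHom_edgeGen]
      exact DFunLike.congr_fun this x
    · rw [← MonoidHom.range_eq_top, FreeGroup.range_lift_eq_closure]
      exact S.closure_range_edgeGen

theorem basis_apply (e : S.Edge) : S.basis e = S.edgeGen e := by
  change FreeGroup.lift S.edgeGen (FreeGroup.of e) = _
  simp

end SchreierSection

end Schreier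

/-! ### Words as elements of a free group, and minimal words -/

/-- The projection of the free group on `ℕ` to the free group on its first `k` letters. -/
def retract (k : ℕ) : FreeGroup ℕ →* FreeGroup (Fin k) :=
  FreeGroup.lift fun a => if h : a < k then FreeGroup.of ⟨a, h⟩ else 1

/-- The inclusion of the free group on the first `k` letters into the free group on `ℕ`. -/
def incl (k : ℕ) : FreeGroup (Fin k) →* FreeGroup ℕ :=
  FreeGroup.map Fin.val

theorem mk_word {k : ℕ} (x : FreeGroup (Fin k)) : FreeGroup.mk (word x) = incl k x := by
  conv_rhs => rw [← FreeGroup.mk_toWord (x := x)]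
  rw [incl, FreeGroup.map.mk]
  rfl

theorem retract_incl {k : ℕ} (x : FreeGroup (Fin k)) : retract k (incl k x) = x := by
  have : (retract k).comp (incl k) = MonoidHom.id _ := by
    ext a; simp [retract, incl]
  exact DFunLike.congr_fun this x

theorem word_eq_toWord_incl {k : ℕ} (x : FreeGroup (Fin k)) : word x = (incl k x).toWord := by
  rw [← mk_word, FreeGroup.toWord_mk, eq_comm]
  refine FreeGroup.IsReduced.reduce_eq ?_
  have := FreeGroup.isReduced_toWord (x := x)
  unfold FreeGroup.IsReduced at this ⊢
  rw [word, List.isChain_map]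
  exact this.imp fun a b h hab => h (Fin.val_injective hab)

/-- The element of the free group on `k` letters given by a word; other letters are ignored. -/
def ev (k : ℕ) (w : Word) : FreeGroup (Fin k) :=
  retract k (FreeGroup.mk w)

@[simp]
theorem ev_nil (k : ℕ) : ev k [] = 1 := map_one _

theorem ev_append (k : ℕ) (v w : Word) : ev k (v ++ w) = ev k v * ev k w := by
  rw [ev, ← FreeGroup.mul_mk, map_mul]; rfl

theorem ev_cons (k : ℕ) (p : ℕ × Bool) (w : Word) : ev k (p :: w) = ev k [p] * ev k w :=
  ev_append k [p] w

theorem ev_invRev (k : ℕ) (w : Word) : ev k (FreeGroup.invRev w) = (ev k w)⁻¹ := by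
  rw [ev, ← FreeGroup.inv_mk, map_inv]; rfl

theorem ev_letter {k : ℕ} (a : Fin k) : ev k [(a.val, true)] = FreeGroup.of a := by
  change retract k (FreeGroup.of a.val) = _
  simp [retract]

theorem ev_letter_inv {k : ℕ} (a : Fin k) : ev k [(a.val, false)] = (FreeGroup.of a)⁻¹ := by
  rw [← ev_letter, ← ev_invRev]; rfl

theorem ev_letter_of_le {k a : ℕ} (h : k ≤ a) (b : Bool) : ev k [(a, b)] = 1 := by
  have ht : ev k [(a, true)] = 1 := by
    change retract k (FreeGroup.of a) = _
    simp [retract, h]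
  cases b
  · rw [show [(a, false)] = FreeGroup.invRev [(a, true)] from rfl, ev_invRev, ht, inv_one]
  · exact ht

theorem ev_word {k : ℕ} (x : FreeGroup (Fin k)) : ev k (word x) = x := by
  rw [ev, mk_word, retract_incl]

theorem mk_filter (k : ℕ) (w : Word) :
    FreeGroup.mk (w.filter fun p => p.1 < k) = incl k (ev k w) := by
  induction w with
  | nil => rfl
  | cons p w ih =>
    obtain ⟨a, b⟩ := p
    rw [ev_cons, map_mul, ← ih]
    by_cases h : a < k
    · have : incl k (ev k [(a, b)]) = FreeGroup.mk [(a, b)] := by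
        cases b
        · exact (congrArg (incl k) (ev_letter_inv ⟨a, h⟩)).trans (by simp [incl]; rfl)
        · exact (congrArg (incl k) (ev_letter ⟨a, h⟩)).trans (by simp [incl]; rfl)
      rw [this, FreeGroup.mul_mk]
      simp [h]
    · rw [ev_letter_of_le (not_lt.1 h)]
      simp [h]

/-- This expresses `ev` purely by operations on words, hence computably. -/
theorem word_ev (k : ℕ) (w : Word) :
    word (ev k w) = FreeGroup.reduce (w.filter fun p => p.1 < k) := by
  rw [word_eq_toWord_incl, ← mk_filter, FreeGroup.toWord_mk]

/-! ### Minimal words as a Schreier transversal -/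

section Minimal

variable {k : ℕ} (H : Subgroup (FreeGroup (Fin k)))

/-- A word is minimal if no word with a smaller code represents the same left coset of `H`. -/
def IsMinimal (w : Word) : Prop :=
  ∀ v : Word, Encodable.encode v < Encodable.encode w → (ev k v)⁻¹ * ev k w ∉ H

theorem exists_isMinimal (q : FreeGroup (Fin k) ⧸ H) :
    ∃ w : Word, (ev k w : FreeGroup (Fin k) ⧸ H) = q ∧ IsMinimal H w := by
  have hne : {w : Word | (ev k w : FreeGroup (Fin k) ⧸ H) = q}.Nonempty := by
    obtain ⟨x, rfl⟩ := QuotientGroup.mk_surjective q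
    exact ⟨word x, by simp [ev_word]⟩
  refine ⟨argminOn Encodable.encode _ hne, argminOn_mem _ _ hne, fun v hv hmem => ?_⟩
  refine not_lt_argminOn (f := Encodable.encode) {w : Word | (ev k w : FreeGroup (Fin k) ⧸ H) = q}
    ?_ hv
  exact (QuotientGroup.eq.2 hmem).trans (argminOn_mem Encodable.encode _ hne)

variable {H} in
theorem IsMinimal.eq {v w : Word} (hv : IsMinimal H v) (hw : IsMinimal H w)
    (h : (ev k v : FreeGroup (Fin k) ⧸ H) = ev k w) : v = w :=
  Encodable.encode_injective <| le_antisymm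
    (not_lt.1 fun hlt => hv w hlt (QuotientGroup.eq.1 h.symm))
    (not_lt.1 fun hlt => hw v hlt (QuotientGroup.eq.1 h))

/-- The minimal word of a left coset. -/
noncomputable def minWord (q : FreeGroup (Fin k) ⧸ H) : Word := (exists_isMinimal H q).choose

theorem mk_ev_minWord (q : FreeGroup (Fin k) ⧸ H) :
    (ev k (minWord H q) : FreeGroup (Fin k) ⧸ H) = q :=
  (exists_isMinimal H q).choose_spec.1

theorem isMinimal_minWord (q : FreeGroup (Fin k) ⧸ H) : IsMinimal H (minWord H q) :=
  (exists_isMinimal H q).choose_spec.2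

variable {H} in
theorem IsMinimal.minWord_eq {w : Word} (hw : IsMinimal H w) {q : FreeGroup (Fin k) ⧸ H}
    (h : (ev k w : FreeGroup (Fin k) ⧸ H) = q) : minWord H q = w :=
  (isMinimal_minWord H q).eq hw ((mk_ev_minWord H q).trans h.symm)

theorem encode_lt_encode_cons (p : ℕ × Bool) (w : Word) :
    Encodable.encode w < Encodable.encode (p :: w) := by
  rw [Encodable.encode_list_cons]
  exact Nat.lt_succ_of_le (Nat.right_le_pair _ _)

/-- A list is coded by pairing head and tail, and pairing is strictly increasing in its second
argument. -/
theorem encode_cons_lt_encode_cons (p : ℕ × Bool) {v w : Word}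
    (h : Encodable.encode v < Encodable.encode w) :
    Encodable.encode (p :: v) < Encodable.encode (p :: w) := by
  rw [Encodable.encode_list_cons, Encodable.encode_list_cons]
  exact Nat.succ_lt_succ (Nat.pair_lt_pair_right _ h)

variable {H} in
-- A smaller word in the coset of `w` would, after prepending `p`, beat `p :: w` in its own coset.
theorem IsMinimal.tail {p : ℕ × Bool} {w : Word} (h : IsMinimal H (p :: w)) : IsMinimal H w := by
  intro v hv hmem
  apply h (p :: v) (encode_cons_lt_encode_cons p hv)
  rw [ev_cons k p v, ev_cons k p w]
  simpa [mul_assoc] using hmem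

variable {H} in
theorem IsMinimal.letter_lt {p : ℕ × Bool} {w : Word} (h : IsMinimal H (p :: w)) : p.1 < k := by
  by_contra hp
  apply h w (encode_lt_encode_cons p w)
  rw [ev_cons k p w, ev_letter_of_le (not_lt.1 hp)]
  simp

theorem isMinimal_nil : IsMinimal H [] := by
  intro v hv
  simp at hv

/-- The Schreier section given by the minimal words. -/
noncomputable def minSection : SchreierSection H where
  rep q := ev k (minWord H q)
  mk_rep := mk_ev_minWord H
  rep_one := by
    rw [(isMinimal_nil H).minWord_eq (by rw [ev_nil]), ev_nil]
  height q := Encodable.encode (minWord H q)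
  parent q hq := by
    have hmin := isMinimal_minWord H q
    have hmk := mk_ev_minWord H q
    rcases hw : minWord H q with _ | ⟨⟨a, b⟩, w⟩
    · rw [hw, ev_nil] at hmk
      exact absurd hmk.symm hq
    rw [hw] at hmin hmk
    have ha : a < k := hmin.letter_lt
    refine ⟨(ev k w : FreeGroup (Fin k) ⧸ H), ?_, ⟨a, ha⟩, ?_⟩
    · rw [hmin.tail.minWord_eq rfl]
      exact encode_lt_encode_cons _ _
    · rw [hmin.tail.minWord_eq rfl, ← hmk, ev_cons]
      cases b
      · right
        rw [show ev k [(a, false)] = (FreeGroup.of (⟨a, ha⟩ : Fin k))⁻¹ from ev_letter_inv ⟨a, ha⟩,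
          MulAction.Quotient.smul_coe]
        simp
      · left
        rw [show ev k [(a, true)] = FreeGroup.of (⟨a, ha⟩ : Fin k) from ev_letter ⟨a, ha⟩,
          MulAction.Quotient.smul_coe]
        simp

end Minimal

/-! ### The computation -/

theorem primrec_reduce : Primrec (FreeGroup.reduce : Word → Word) := by
  have h : Primrec fun w : Word => w.foldr (fun x acc =>
      List.casesOn (motive := fun _ => Word) acc [x] fun y l =>
        if x.1 = y.1 ∧ x.2 = !y.2 then l else x :: y :: l) [] := by
    refine Primrec.list_foldr (h := fun _ q => List.casesOn (motive := fun _ => Word) q.2 [q.1]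
      fun y l => if q.1.1 = y.1 ∧ q.1.2 = !y.2 then l else q.1 :: y :: l)
      Primrec.id (Primrec.const []) ?_
    refine Primrec.list_casesOn (f := fun a : Word × (ℕ × Bool) × Word => a.2.2)
      (h := fun a b => if a.2.1.1 = b.1.1 ∧ a.2.1.2 = !b.1.2 then b.2 else a.2.1 :: b.1 :: b.2)
      (Primrec.snd.comp .snd)
      (Primrec.list_cons.comp (Primrec.fst.comp .snd) (Primrec.const [])) ?_
    have h1 : Primrec fun z : (Word × (ℕ × Bool) × Word) × (ℕ × Bool) × Word => z.1.2.1 :=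
      Primrec.fst.comp (Primrec.snd.comp .fst)
    have h2 : Primrec fun z : (Word × (ℕ × Bool) × Word) × (ℕ × Bool) × Word => z.2.1 :=
      Primrec.fst.comp .snd
    have h3 : Primrec fun z : (Word × (ℕ × Bool) × Word) × (ℕ × Bool) × Word => z.2.2 :=
      Primrec.snd.comp .snd
    exact Primrec.ite
      (.and (Primrec.eq.comp (Primrec.fst.comp h1) (Primrec.fst.comp h2))
        (Primrec.eq.comp (Primrec.snd.comp h1) (Primrec.not.comp (Primrec.snd.comp h2))))
      h3 (Primrec.list_cons.comp h1 (Primrec.list_cons.comp h2 h3))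
  refine h.of_eq fun w => ?_
  induction w with
  | nil => rfl
  | cons x w ih => rw [List.foldr_cons, ih]; rfl

theorem primrec_invRev : Primrec (FreeGroup.invRev : Word → Word) :=
  Primrec.list_reverse.comp <| Primrec.list_map .id <|
    (Primrec.pair (Primrec.fst.comp .snd) (Primrec.not.comp (Primrec.snd.comp .snd))).to₂

/-- The image of a letter under the homomorphism with the given list of images of generators. -/
def letterImage (L : List Word) (p : ℕ × Bool) : Word :=
  if p.2 = true then L.getD p.1 [] else FreeGroup.invRev (L.getD p.1 [])

/-- The image of a word under the homomorphism with the given list of images of generators. -/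
def wordImage (L : List Word) (w : Word) : Word :=
  FreeGroup.reduce (w.flatMap (letterImage L))

theorem primrec_letterImage : Primrec₂ letterImage := by
  have h : Primrec fun z : List Word × ℕ × Bool => z.1.getD z.2.1 [] :=
    (Primrec.list_getD ([] : Word)).comp .fst (Primrec.fst.comp .snd)
  exact Primrec.ite (Primrec.eq.comp (Primrec.snd.comp .snd) (Primrec.const true)) h
    (primrec_invRev.comp h)

theorem primrec_wordImage : Primrec₂ wordImage :=
  primrec_reduce.comp <| Primrec.list_flatMap .snd <|
    (primrec_letterImage.comp (Primrec.fst.comp .fst) .snd).to₂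

/-- The default `[]` for letters outside the alphabet agrees with `ev`, which sends them to 1. -/
theorem mk_letterImage {k m : ℕ} (f : FreeGroup (Fin k) →* FreeGroup (Fin m)) (p : ℕ × Bool) :
    FreeGroup.mk (letterImage (List.ofFn fun i => word (f (FreeGroup.of i))) p) =
      incl m (f (ev k [p])) := by
  obtain ⟨a, b⟩ := p
  by_cases h : a < k
  · have e : (List.ofFn fun i => word (f (FreeGroup.of i))).getD a [] =
        word (f (FreeGroup.of ⟨a, h⟩)) := by
      simp [List.getD_eq_getElem?_getD, h]
    unfold letterImage
    rw [e]
    cases b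
    · rw [show ev k [(a, false)] = (FreeGroup.of (⟨a, h⟩ : Fin k))⁻¹ from ev_letter_inv ⟨a, h⟩]
      simp [← FreeGroup.inv_mk, mk_word]
    · rw [show ev k [(a, true)] = FreeGroup.of (⟨a, h⟩ : Fin k) from ev_letter ⟨a, h⟩]
      simp [mk_word]
  · have e : (List.ofFn fun i => word (f (FreeGroup.of i))).getD a [] = [] := by
      simp [List.getD_eq_getElem?_getD, h]
    rw [letterImage, e, ev_letter_of_le (not_lt.1 h)]
    simp [FreeGroup.invRev, ← FreeGroup.one_eq_mk]

theorem wordImage_ofFn {k m : ℕ} (f : FreeGroup (Fin k) →* FreeGroup (Fin m)) (w : Word) :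
    wordImage (List.ofFn fun i => word (f (FreeGroup.of i))) w = word (f (ev k w)) := by
  rw [word_eq_toWord_incl, wordImage, ← FreeGroup.toWord_mk]
  congr 1
  induction w with
  | nil => simp [← FreeGroup.one_eq_mk]
  | cons p w ih =>
    rw [List.flatMap_cons, ← FreeGroup.mul_mk, ih, mk_letterImage, ev_cons k p w]
    simp

/-- The two images of a word agree. -/
def InEq (c : InstanceCode) (w : Word) : Prop :=
  wordImage c.2.2.1 w = wordImage c.2.2.2 w

theorem inEq_code (I : Instance) (w : Word) : InEq I.code w ↔ ev I.k w ∈ I.eq := by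
  have hinj : Injective (word : FreeGroup (Fin I.m) → Word) := fun x y h => by
    rw [← ev_word x, h, ev_word]
  rw [InEq, Instance.code, wordImage_ofFn, wordImage_ofFn]
  exact hinj.eq_iff

theorem primrecRel_inEq : PrimrecRel InEq :=
  Primrec.eq.comp
    (primrec_wordImage.comp (Primrec.fst.comp (Primrec.snd.comp (Primrec.snd.comp .fst))) .snd)
    (primrec_wordImage.comp (Primrec.snd.comp (Primrec.snd.comp (Primrec.snd.comp .fst))) .snd)

/-- The word with a given code. -/
def wordOfCode (n : ℕ) : Word := (Encodable.decode n).getD []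

/-- The computable form of `IsMinimal`. -/
def IsMinimalFor (c : InstanceCode) (w : Word) : Prop :=
  -- The first conjunct discards numbers that code no word, where `wordOfCode` returns its default.
  ∀ n < Encodable.encode w, ¬ (Encodable.encode (wordOfCode n) = n ∧
    InEq c (FreeGroup.invRev (wordOfCode n) ++ w))

theorem isMinimalFor_code (I : Instance) (w : Word) :
    IsMinimalFor I.code w ↔ IsMinimal I.eq w := by
  unfold IsMinimalFor IsMinimal
  simp only [inEq_code, ev_append, ev_invRev, not_and]
  constructor
  · intro h v hv
    have : wordOfCode (Encodable.encode v) = v := by simp [wordOfCode]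
    simpa [this] using h _ hv
  · intro h n hn he
    exact h _ (he.trans_lt hn)

theorem primrecRel_isMinimalFor : PrimrecRel IsMinimalFor := by
  have hw : Primrec wordOfCode := Primrec.option_getD.comp Primrec.decode (Primrec.const [])
  have h : PrimrecRel fun (n : ℕ) (p : InstanceCode × Word) =>
      ¬ (Encodable.encode (wordOfCode n) = n ∧
        InEq p.1 (FreeGroup.invRev (wordOfCode n) ++ p.2)) := by
    have hn : Primrec fun z : ℕ × InstanceCode × Word => wordOfCode z.1 := hw.comp .fst
    refine PrimrecPred.not (.and (Primrec.eq.comp (Primrec.encode.comp hn) .fst) ?_)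
    exact primrecRel_inEq.comp (Primrec.fst.comp .snd)
      (Primrec.list_append.comp (primrec_invRev.comp hn) (Primrec.snd.comp .snd))
  exact (h.forall_mem_list.comp (Primrec.list_range.comp (Primrec.encode.comp .snd)) .id).of_eq
    fun _ => by simp [IsMinimalFor]

/-- The data describing a Schreier generator: a letter, the minimal word of its starting point
(last), and the minimal word of its end point (first). -/
abbrev Triple := Word × ℕ × Word

/-- The loop given by a triple, as an unreduced word. -/
def loopWord (t : Triple) : Word := FreeGroup.invRev t.1 ++ (t.2.1, true) :: t.2.2

/-- The element of the free group given by a triple, as a reduced word. -/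
def genWord (c : InstanceCode) (t : Triple) : Word :=
  FreeGroup.reduce ((loopWord t).filter fun p => p.1 < c.1)

/-- The triple describes a nontrivial Schreier generator. -/
def Valid (t : Triple) (c : InstanceCode) : Prop :=
  -- The loop lies in the equaliser exactly when the first word represents the end point of the
  -- edge.
  t.2.1 < c.1 ∧ IsMinimalFor c t.1 ∧ IsMinimalFor c t.2.2 ∧ InEq c (loopWord t) ∧ genWord c t ≠ []

theorem primrec_loopWord : Primrec loopWord :=
  Primrec.list_append.comp (primrec_invRev.comp .fst) <| Primrec.list_cons.comp
    (Primrec.pair (Primrec.fst.comp .snd) (Primrec.const true)) (Primrec.snd.comp .snd)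

theorem primrec_genWord : Primrec₂ genWord := by
  have h : PrimrecRel fun (p : ℕ × Bool) (k : ℕ) => p.1 < k :=
    Primrec.nat_lt.comp (Primrec.fst.comp .fst) .snd
  exact primrec_reduce.comp
    (h.listFilter.comp (primrec_loopWord.comp .snd) (Primrec.fst.comp .fst))

theorem primrecRel_valid : PrimrecRel Valid :=
  .and (Primrec.nat_lt.comp (Primrec.fst.comp (Primrec.snd.comp .fst)) (Primrec.fst.comp .snd)) <|
  .and (primrecRel_isMinimalFor.comp .snd (Primrec.fst.comp .fst)) <|
  .and (primrecRel_isMinimalFor.comp .snd (Primrec.snd.comp (Primrec.snd.comp .fst))) <|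
  .and (primrecRel_inEq.comp .snd (primrec_loopWord.comp .fst)) <|
  .not (Primrec.eq.comp (primrec_genWord.comp .snd .fst) (Primrec.const []))

open Classical in
/-- The valid triples with code below `N`. -/
noncomputable def triples (c : InstanceCode) (N : ℕ) : List Triple :=
  ((List.range N).filterMap (Encodable.decode₂ Triple)).filter fun t => Valid t c

theorem mem_triples {c : InstanceCode} {N : ℕ} {t : Triple} :
    t ∈ triples c N ↔ Encodable.encode t < N ∧ Valid t c := by
  simp [triples, Encodable.decode₂_eq_some]

/-- `Encodable.decode₂` accepts only the canonical code of a triple. Without repetitions, the length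
of the list can be compared with the rank. -/
theorem nodup_triples (c : InstanceCode) (N : ℕ) : (triples c N).Nodup := by
  refine List.Nodup.filter _ (List.Nodup.filterMap ?_ List.nodup_range)
  intro n n' t h h'
  rw [Encodable.mem_decode₂] at h h'
  exact h.symm.trans h'

theorem primrec_triples : Primrec₂ triples := by
  have h : Primrec (Encodable.decode₂ Triple) :=
    Primrec.option_bind .decode <| Primrec.option_guard
      (p := fun (z : ℕ × Triple) (t : Triple) => Encodable.encode t = z.1)
      (Primrec.eq.comp (Primrec.encode.comp .snd) (Primrec.fst.comp .fst)) .snd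
  classical
  exact primrecRel_valid.listFilter.comp
    (Primrec.listFilterMap (Primrec.list_range.comp .snd) (h.comp .snd).to₂) .fst

/-- The algorithm that finds a basis of the equaliser of an instance from its rank. -/
noncomputable def basisFromRank : InstanceCode × ℕ →. List Word := fun p =>
  (Nat.rfind fun N => Part.some (decide ((triples p.1 N).length = p.2))).map fun N =>
    (triples p.1 N).map (genWord p.1)

theorem partrec_basisFromRank : Partrec basisFromRank := by
  have hT : Primrec fun z : (InstanceCode × ℕ) × ℕ => triples z.1.1 z.2 :=
    primrec_triples.comp (Primrec.fst.comp .fst) .snd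
  have hp : Primrec fun z : (InstanceCode × ℕ) × ℕ =>
      decide ((triples z.1.1 z.2).length = z.1.2) :=
    (Primrec.eq.comp (Primrec.list_length.comp hT) (Primrec.snd.comp .fst)).decide
  have hc : Primrec fun z : ((InstanceCode × ℕ) × ℕ) × Triple => z.1.1.1 :=
    Primrec.fst.comp (Primrec.fst.comp .fst)
  have hg : Primrec₂ fun (z : (InstanceCode × ℕ) × ℕ) (t : Triple) => genWord z.1.1 t :=
    primrec_genWord.comp hc .snd
  have hr : Partrec₂ fun (p : InstanceCode × ℕ) (N : ℕ) =>
      Part.some (decide ((triples p.1 N).length = p.2)) := hp.to_comp.partrec.to₂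
  exact (Partrec.rfind hr).map (Primrec.list_map hT hg).to_comp.to₂

/-! ### Correctness of the algorithm -/

section Correctness

variable (I : Instance)

theorem ev_loopWord (v w : Word) (a : Fin I.k) :
    ev I.k (loopWord (v, a.val, w)) = (ev I.k v)⁻¹ * (FreeGroup.of a * ev I.k w) := by
  rw [loopWord, ev_append, ev_invRev, ev_cons _ (_, true), ev_letter]

theorem genWord_code (t : Triple) : genWord I.code t = word (ev I.k (loopWord t)) :=
  (word_ev I.k _).symm

theorem genWord_code_eq_nil (t : Triple) : genWord I.code t = [] ↔ ev I.k (loopWord t) = 1 := by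
  rw [genWord_code]
  constructor
  · intro h
    rw [← ev_word (ev I.k (loopWord t)), h, ev_nil]
  · intro h
    simp [h, word]

/-- The triple of an edge of the Schreier graph. -/
noncomputable def tripleOf (a : Fin I.k) (q : FreeGroup (Fin I.k) ⧸ I.eq) : Triple :=
  (minWord I.eq (FreeGroup.of a • q), a.val, minWord I.eq q)

theorem ev_loopWord_tripleOf (a : Fin I.k) (q : FreeGroup (Fin I.k) ⧸ I.eq) :
    ev I.k (loopWord (tripleOf I a q)) = (minSection I.eq).gen a q :=
  ev_loopWord I _ _ a

theorem valid_tripleOf (e : (minSection I.eq).Edge) : Valid (tripleOf I e.1.1 e.1.2) I.code := by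
  refine ⟨e.1.1.isLt, (isMinimalFor_code I _).2 (isMinimal_minWord _ _),
    (isMinimalFor_code I _).2 (isMinimal_minWord _ _), (inEq_code I _).2 ?_, ?_⟩
  · rw [ev_loopWord_tripleOf]
    exact SchreierSection.gen_mem _ _ _
  · rw [Ne, genWord_code_eq_nil, ev_loopWord_tripleOf]
    exact e.2

/-- The edges outside the tree of minimal words correspond to the valid triples. -/
noncomputable def edgeEquiv : (minSection I.eq).Edge ≃ {t // Valid t I.code} :=
  Equiv.ofBijective (fun e => ⟨tripleOf I e.1.1 e.1.2, valid_tripleOf I e⟩) <| by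
    constructor
    · rintro ⟨⟨a, q⟩, h⟩ ⟨⟨b, p⟩, h'⟩ heq
      have ht : tripleOf I a q = tripleOf I b p := congrArg Subtype.val heq
      simp only [tripleOf, Prod.mk.injEq] at ht
      have hq : q = p := by
        rw [← mk_ev_minWord I.eq q, ht.2.2, mk_ev_minWord]
      have hab : a = b := Fin.ext ht.2.1
      subst hq hab
      rfl
    · rintro ⟨⟨v, a, w⟩, ha, hv, hw, hmem, hne⟩
      obtain ⟨a, rfl⟩ : ∃ b : Fin I.k, b.val = a := ⟨⟨a, ha⟩, rfl⟩
      rw [isMinimalFor_code] at hv hw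
      rw [inEq_code, ev_loopWord, ← QuotientGroup.eq] at hmem
      have hqw : minWord I.eq (ev I.k w : FreeGroup (Fin I.k) ⧸ I.eq) = w := hw.minWord_eq rfl
      have hqv : minWord I.eq (FreeGroup.of a • (ev I.k w : FreeGroup (Fin I.k) ⧸ I.eq)) = v :=
        hv.minWord_eq hmem
      have ht : tripleOf I a (ev I.k w) = (v, a.val, w) := by rw [tripleOf, hqw, hqv]
      refine ⟨⟨(a, (ev I.k w : FreeGroup (Fin I.k) ⧸ I.eq)), ?_⟩, Subtype.ext ht⟩
      rw [← ev_loopWord_tripleOf, ht]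
      exact mt (genWord_code_eq_nil I _).2 hne

theorem word_edgeGen_edgeEquiv_symm (t : {t // Valid t I.code}) :
    word ((minSection I.eq).edgeGen ((edgeEquiv I).symm t) : FreeGroup (Fin I.k)) =
      genWord I.code t := by
  obtain ⟨e, rfl⟩ := (edgeEquiv I).surjective t
  rw [Equiv.symm_apply_apply, genWord_code]
  exact congrArg word (ev_loopWord_tripleOf I e.1.1 e.1.2).symm

variable {I}

/-- A list of all valid triples without repetitions gives a basis of the equaliser. -/
theorem isEqBasis_map_genWord {l : List Triple} (hl : l.Nodup)
    (hmem : ∀ t, t ∈ l ↔ Valid t I.code) : I.IsEqBasis (l.map (genWord I.code)) := by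
  let e : (minSection I.eq).Edge ≃ Fin (l.map (genWord I.code)).length :=
    (edgeEquiv I).trans <| (Equiv.subtypeEquivRight fun t => (hmem t).symm).trans <|
      (hl.getEquiv l).symm.trans (finCongr (List.length_map _).symm)
  refine ⟨(minSection I.eq).basis.reindex e, fun i => ?_⟩
  rw [FreeGroupBasis.reindex_apply, SchreierSection.basis_apply]
  change word ((minSection I.eq).edgeGen ((edgeEquiv I).symm _) : FreeGroup (Fin I.k)) = _
  rw [word_edgeGen_edgeEquiv_symm]
  simp

/-- Two bases of a free group, one of them finite, are in bijection. -/
theorem nonempty_equiv_of_basis {G ι : Type*} [Group G] {r : ℕ} (b : FreeGroupBasis ι G)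
    (c : FreeGroupBasis (Fin r) G) : Nonempty (ι ≃ Fin r) := by
  -- Both sides count the homomorphisms from `G` to the group of order 2.
  have e : (ι → Multiplicative (ZMod 2)) ≃ (Fin r → Multiplicative (ZMod 2)) :=
    b.lift.trans c.lift.symm
  have : Nontrivial (Multiplicative (ZMod 2)) := inferInstanceAs (Nontrivial (ZMod 2))
  have : Finite (Multiplicative (ZMod 2)) := inferInstanceAs (Finite (ZMod 2))
  have : Finite (ι → Multiplicative (ZMod 2)) := .of_equiv _ e.symm
  have : Finite ι := by
    classical
    -- The indicator functions of points embed `ι` into a finite set.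
    refine Finite.of_injective (fun i : ι => Pi.mulSingle (M := fun _ => Multiplicative (ZMod 2)) i
      (Multiplicative.ofAdd 1)) fun i j hij => ?_
    by_contra hne
    have := congrFun hij i
    simp [hne] at this
  have hc : Nat.card (Multiplicative (ZMod 2)) = 2 := Nat.card_zmod 2
  have h := Nat.card_congr e
  rw [Nat.card_fun, Nat.card_fun, hc, Nat.card_fin] at h
  exact ⟨Finite.equivFinOfCardEq (Nat.pow_right_injective le_rfl h)⟩

theorem exists_mem_basisFromRank {r : ℕ} (hr : I.IsEqRank r) :
    ∃ L ∈ basisFromRank (I.code, r), I.IsEqBasis L := by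
  obtain ⟨c⟩ := hr
  obtain ⟨e⟩ := nonempty_equiv_of_basis ((minSection I.eq).basis.reindex (edgeEquiv I)) c
  have hfin : {t | Valid t I.code}.Finite := Finite.of_equiv _ e.symm
  have hcard : {t | Valid t I.code}.ncard = r := by
    rw [← Nat.card_coe_set_eq, ← Nat.card_fin r]
    exact Nat.card_congr e
  have hsub : ∀ N, {t | t ∈ triples I.code N} ⊆ {t | Valid t I.code} :=
    fun N t ht => (mem_triples.1 ht).2
  have hlen : ∀ N, {t | t ∈ triples I.code N}.ncard = (triples I.code N).length := by
    classical
    intro N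
    rw [← List.coe_toFinset, Set.ncard_coe_finset, List.toFinset_card_of_nodup (nodup_triples _ _)]
  obtain ⟨M, hM⟩ := (hfin.image Encodable.encode).bddAbove
  have hall : {t | t ∈ triples I.code (M + 1)} = {t | Valid t I.code} :=
    (hsub _).antisymm fun t ht =>
      mem_triples.2 ⟨Nat.lt_succ_of_le (hM ⟨t, ht, rfl⟩), ht⟩
  -- Beyond the largest code of a valid triple the list is complete, so the search halts, possibly
  -- earlier.
  obtain ⟨N, hN, -⟩ := Nat.rfind_min'
    (p := fun N => decide ((triples I.code N).length = r)) (m := M + 1)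
    (by rw [decide_eq_true_eq, ← hlen, hall, hcard])
  have hNr : (triples I.code N).length = r := by
    simpa using Nat.rfind_spec hN
  refine ⟨_, Part.mem_map _ hN, isEqBasis_map_genWord (nodup_triples _ _) fun t => ?_⟩
  -- Wherever it halts, r distinct valid triples out of r are all of them.
  have := Set.eq_of_subset_of_ncard_le (hsub N) (by rw [hlen, hNr, hcard]) hfin
  exact Set.ext_iff.1 this t

end Correctness

/-! ### The equivalence of the two problems -/

theorem Instance.IsEqBasis.isEqRank {I : Instance} {L : List Word} (h : I.IsEqBasis L) :
    I.IsEqRank L.length :=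
  ⟨h.choose⟩

theorem SolvesBP.solvesRP {C : Set Instance} {f : InstanceCode →. List Word} (hf : SolvesBP C f) :
    SolvesRP C fun c => (f c).map List.length := by
  intro I hI
  obtain ⟨L, hL, hB⟩ := hf I hI
  exact ⟨L.length, Part.mem_map _ hL, hB.isEqRank⟩

theorem SolvesRP.solvesBP {C : Set Instance} {f : InstanceCode →. ℕ} (hf : SolvesRP C f) :
    SolvesBP C fun c => (f c).bind fun r => basisFromRank (c, r) := by
  intro I hI
  obtain ⟨r, hr, hI⟩ := hf I hI
  obtain ⟨L, hL, hB⟩ := exists_mem_basisFromRank hI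
  exact ⟨L, Part.mem_bind hr hL, hB⟩

/-- Post-processing the answer of an oracle together with its question. -/
theorem recursiveIn_bind_oracle {α β σ : Type} [Primcodable α] [Primcodable β] [Primcodable σ]
    (f : α →. β) {A : α × β →. σ} (hA : Partrec A) :
    RecursiveIn {oracle f} fun a => (f a).bind fun b => A (a, b) := by
  have hA' : Nat.RecursiveIn {oracle f}
      fun n => Part.bind (Encodable.decode (α := α × β) n) fun a => (A a).map Encodable.encode :=
    hA.recursiveIn
  have hid : Nat.RecursiveIn {oracle f} (Part.some : ℕ →. ℕ) :=
    RecursiveIn.iff_nat.1 RecursiveIn.some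
  -- The question is kept next to the answer, so their pair codes the input of `A`.
  refine (hA'.comp (hid.pair (.oracle (oracle f) rfl))).of_eq fun n => ?_
  rcases h : Encodable.decode (α := α) n with _ | a
  · simp [oracle, h, Seq.seq]
  · simp [oracle, h, Seq.seq, Part.bind_map, Part.map_bind]

theorem bpEquivRP (C : Set Instance) : BPEquivRP C := by
  refine ⟨⟨?_, ?_⟩, ?_, ?_⟩
  · rintro ⟨f, hf, hC⟩
    exact ⟨_, hf.map (Computable.list_length.comp .snd).to₂, hC.solvesRP⟩
  · rintro ⟨f, hf, hC⟩
    exact ⟨_, hf.bind partrec_basisFromRank.to₂, hC.solvesBP⟩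
  · intro f hC
    refine ⟨_, hC.solvesRP, ?_⟩
    have h : Partrec fun p : InstanceCode × List Word => Part.some p.2.length :=
      (Computable.list_length.comp .snd).partrec
    exact (recursiveIn_bind_oracle f h).of_eq fun c => Part.bind_some_eq_map _ _
  · intro f hC
    exact ⟨_, hC.solvesBP, recursiveIn_bind_oracle f partrec_basisFromRank⟩

end FreePCP

theorem mainTheorem4 :
    (∃ A : FreePCP.InstanceCode × ℕ →. List FreePCP.Word, Partrec A ∧
      ∀ I ∈ FreePCP.atLeastOneInj, ∀ r : ℕ, I.IsEqRank r →
        ∃ L ∈ A (I.code, r), I.IsEqBasis L) ∧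
    (∀ C ∈ ({FreePCP.exactlyOneInj, FreePCP.bothInj, FreePCP.atLeastOneInj} :
        Set (Set FreePCP.Instance)),
      (∀ n : ℕ, FreePCP.BPEquivRP (C ∩ FreePCP.ofSize n)) ∧ FreePCP.BPEquivRP C) :=
  ⟨⟨FreePCP.basisFromRank, FreePCP.partrec_basisFromRank,
      fun _ _ _ hr => FreePCP.exists_mem_basisFromRank hr⟩,
    fun C _ => ⟨fun n => FreePCP.bpEquivRP (C ∩ FreePCP.ofSize n), FreePCP.bpEquivRP C⟩⟩
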